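/- **Notation.** For $\sigma=\sigma_1\cdots\sigma_m\in\mathfrak S_m$ let $\mathrm{des}(\sigma)=|\{i<m:\sigma_i>\sigma_{i+1}\}|$, $\mathrm{maj}(\sigma)=\sum_{\sigma_i>\sigma_{i+1}}i$, $\mathrm{lrmin}(\sigma)=|\{i:\sigma_i<\sigma_j\ \forall j<i\}|$, $\mathrm{rlmin}(\sigma)=|\{i:\sigma_i<\sigma_j\ \forall j>i\}|$, and, for parameters $\alpha,\beta$, let the mixed major index be $$\widetilde{\mathrm{maj}}(\sigma)=(1+\mathrm{des}(\sigma)-\mathrm{lrmin}(\sigma))(\alpha-1)+(m-\mathrm{rlmin}(\sigma))(\beta-1)+\mathrm{maj}(\sigma).$$ Let $\mathfrak S_{m,k}$ be the set of permutations in $\mathfrak S_m$ with exactly $k$ descents. Put $[x]=\frac{1-q^x}{1-q}$ (and $[x]=x$ if $q=1$) and $[m]!=[1][2]\cdots[m]$ for $m\in\mathbb N$. For a sequence $c=(c_1,\dots,c_r)$ of non-negative integers with $c_1+\cdots+c_r=r$, the remixed Eulerian number $A_c(q)$ of Nadeau and Tewari is defined by $[r]!\,u_1^{c_1}\cdots u_r^{c_r}=A_c(q)\,u_1u_2\cdots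 u_r$ in the $q$-Klyachko algebra, i.e. the commutative $\mathbb Q(q)$-algebra generated by $u_1,\dots,u_r$ with relations $(1+q)u_i^2=q\,u_iu_{i-1}+u_iu_{i+1}$ for $1\le i\le r$, where $u_0=u_{r+1}=0$. For integers $\alpha,\beta\ge1$ and $r,s\ge 0$, Gaudin's $q$-Carlitz–Scoville number is $$A(r,s\,|\,\alpha,\beta)_q=\frac{1}{[\alpha+\beta-1]!}\,A_{(0^r,\,1^{\beta-1},\,r+s+1,\,1^{\alpha-1},\,0^s)}(q).$$ **Theorem.** Let $n\ge k\ge0$ be integers. (a) For all integers $\alpha,\beta\ge1$, the number $E_{n,k}(\alpha,\beta,q):=A(k,n-k\,|\,\alpha,\beta)_q$ satisfies, in $\mathbb Q(q)$, $$E_{n,k}(\alpha,\beta,q)=\sum_{\sigma\in\mathfrak S_{n+1,k}}[\alpha]^{\mathrm{lrmin}(\sigma)-1}[\beta]^{\mathrm{rlmin}(\sigma)-1}q^{\widetilde{\mathrm{maj}}(\sigma)}.$$ (b) The same formula holds for all real $\alpha,\beta$ and all real $q>0$, where $E_{n,k}(\alpha,\beta,q)$ is now given by the recurrence $E_{n,k}=q^{\beta+k-1}[n-k+\alpha]E_{n-1,k-1}+[k+\beta]E_{n-1,k}$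 for $n\ge1$, with $E_{0,0}=1$ and $E_{n,k}=0$ for $k\notin\{0,\dots,n\}$. -/

import Mathlib

/-! ### The `q`-Klyachko algebra and the remixed Eulerian numbers -/

namespace RemixedEulerian

noncomputable section

/-- The field `ℚ(q)`. -/
abbrev Kq : Type := RatFunc ℚ

/-- The indeterminate `q`. -/
def q : Kq := RatFunc.X

/-- The generators `u₁, …, u_r` of a polynomial ring in `r` variables, with the convention
`u_j = 0` for `j ∉ {1, …, r}`. -/
def u (r j : ℕ) : MvPolynomial (Fin r) Kq :=
  if h : 1 ≤ j ∧ j ≤ r then MvPolynomial.X ⟨j - 1, by omega⟩ else 0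

/-- The defining relations `(1 + q) u_j² = q u_j u_{j-1} + u_j u_{j+1}`, `1 ≤ j ≤ r`, with
`u_0 = u_{r+1} = 0`. -/
def relations (r : ℕ) : Ideal (MvPolynomial (Fin r) Kq) :=
  Ideal.span {p | ∃ j, 1 ≤ j ∧ j ≤ r ∧
    p = MvPolynomial.C (1 + q) * u r j ^ 2
      - (MvPolynomial.C q * u r j * u r (j - 1) + u r j * u r (j + 1))}

/-- The `q`-Klyachko algebra (over `ℚ(q)`) on `r` generators. -/
abbrev Klyachko (r : ℕ) : Type := MvPolynomial (Fin r) Kq ⧸ relations r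

/-- The monomial `u₁^{c₁} ⋯ u_r^{c_r}` in the `q`-Klyachko algebra. -/
def mono (r : ℕ) (c : Fin r → ℕ) : Klyachko r :=
  Ideal.Quotient.mk (relations r) (∏ i : Fin r, MvPolynomial.X i ^ c i)

/-- The `q`-integer `[m] = 1 + q + ⋯ + q^{m-1}`. -/
def qInt (m : ℕ) : Kq := ∑ i ∈ Finset.range m, q ^ i

/-- The `q`-factorial `[m]! = [1][2]⋯[m]`. -/
def qFactorial (m : ℕ) : Kq := ∏ i ∈ Finset.range m, qInt (i + 1)

/-- The remixed Eulerian number `A_c(q)`, for `c = (c₁, …, c_r)` with `c₁ + ⋯ + c_r = r`: the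
scalar with `[r]! u₁^{c₁} ⋯ u_r^{c_r} = A_c(q) u₁ u₂ ⋯ u_r` in the `q`-Klyachko algebra. -/
def remixed (c : List ℕ) : Kq :=
  Classical.epsilon fun a : Kq =>
    qFactorial c.length • mono c.length c.get = a • mono c.length (fun _ => 1)

/-- The `q`-Carlitz–Scoville number `A(r, s | α, β)_q` for positive integers `α`, `β`. -/
def carlitzScoville (r s α β : ℕ) : Kq :=
  remixed (List.replicate r 0 ++ List.replicate (β - 1) 1 ++ [r + s + 1] ++
      List.replicate (α - 1) 1 ++ List.replicate s 0)
    / qFactorial (α + β - 1)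

/-- `E_{n,k}(α, β, q) = A(k, n - k | α, β)_q` for `0 ≤ k ≤ n`, and `0` otherwise. -/
def E (n k α β : ℕ) : Kq := if k ≤ n then carlitzScoville k (n - k) α β else 0

end

end RemixedEulerian

/-! ### Permutation statistics -/

namespace PermStat

/-- The descents of `σ`, as a set of (zero-based) positions. -/
def descents {n : ℕ} (σ : Equiv.Perm (Fin n)) : Finset (Fin n) :=
  {i | ∃ j : Fin n, (j : ℕ) = (i : ℕ) + 1 ∧ σ j < σ i}

/-- The number of descents. -/
def des {n : ℕ} (σ : Equiv.Perm (Fin n)) : ℕ := (descents σ).card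

/-- The major index; the zero-based position `i` is position `i + 1` of the word. -/
def maj {n : ℕ} (σ : Equiv.Perm (Fin n)) : ℕ := ∑ i ∈ descents σ, ((i : ℕ) + 1)

/-- The number of left-to-right minima. -/
def lrmin {n : ℕ} (σ : Equiv.Perm (Fin n)) : ℕ :=
  (Finset.univ.filter fun i : Fin n => ∀ j, j < i → σ i < σ j).card

/-- The number of right-to-left minima. -/
def rlmin {n : ℕ} (σ : Equiv.Perm (Fin n)) : ℕ :=
  (Finset.univ.filter fun i : Fin n => ∀ j, i < j → σ i < σ j).card

/-- The mixed major index with parameters `α`, `β` (integers or real numbers). -/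
def mixedMaj {R : Type*} [CommRing R] (α β : R) {n : ℕ} (σ : Equiv.Perm (Fin n)) : R :=
  (1 + (des σ : R) - (lrmin σ : R)) * (α - 1) + ((n : R) - (rlmin σ : R)) * (β - 1) + (maj σ : R)

end PermStat

/-! ### Arbitrary real parameters -/

namespace RealParam

noncomputable section

/-- The `q`-real number `[x]`, with its limit value `x` at `q = 1`. -/
def qReal (q x : ℝ) : ℝ := if q = 1 then x else (1 - q ^ x) / (1 - q)

/-- The continuation of `E_{n,k}(α, β, q)` to real `α`, `β`, by the recurrence
`E_{n,k} = q^{β+k-1} [n-k+α] E_{n-1,k-1} + [k+β] E_{n-1,k}`, with `E_{0,0} = 1`, `E_{0,k} = 0`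
for `k ≠ 0` and `E_{n,-1} = 0`. -/
def E (α β q : ℝ) : ℕ → ℕ → ℝ
  | 0, 0 => 1
  | 0, _ + 1 => 0
  | n + 1, 0 => qReal q β * E α β q n 0
  | n + 1, k + 1 =>
      q ^ (β + k) * qReal q ((n : ℝ) - k + α) * E α β q n k
        + qReal q ((k : ℝ) + 1 + β) * E α β q n (k + 1)

end

end RealParam

/-!
Both sides of the identity satisfy the same recurrence in `n`, namely
`E_{n+1,k+1} = y q^(k+1) (a + x q [n-k]) E_{n,k} + (b + y q [k+1]) E_{n,k+1}` with `a = [α]`,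
`b = [β]`, `x = q^(α-1)`, `y = q^(β-1)`.

*Permutations.* Insert the largest letter into a permutation of `n + 1` letters with `d` descents.
At the front it adds a left-to-right minimum, at the end a right-to-left minimum. In the `d`
descents it preserves `des` and raises `maj` by `1, …, d`; in the `n - d` ascents it raises `des`
by one and `maj` by `d + 2, …, n + 1`. Hence the recurrence holds with `a`, `b`, `x`, `y`
independent (`weightSum_succ_zero`, `weightSum_succ_succ`), and part (b) follows by induction.

*Klyachko algebra.* For `p` in an interval, `(1 + q) u_p² = q u_p u_{p-1} + u_p u_{p+1}` says that
`u_p` times the interval monomial is harmonic in `p` for a biased walk. Solving this second-order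
recurrence writes the product as a combination, with `q`-integer coefficients, of the two interval
monomials extended by one site (`qNat_smul_mul_interval`). Multiplying `n` times by the same `u_p`
is then a weighted count of lattice paths, which obeys the recurrence above, and only one interval
fits into `{1, …, r}` at the end (`prod_qNat_smul_pow_mul_interval_eq`).

*Uniqueness.* The remixed Eulerian number is determined by its defining equation only if
`u₁ ⋯ u_r ≠ 0` (`mono_one_ne_zero`). This is shown by letting `u_p` act on formal combinations of
finite sets of occupied sites: a particle dropped at `p` walks until it leaves the occupied set,
and the outcome, as a function of `p`, solves a discrete Dirichlet problem. The operators commute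
(`dropOp_comm`) because dropping at `p` and `p'` gives a function harmonic in each variable with
symmetric boundary values, and `u₁ ⋯ u_r` sends the empty set to `{1, …, r}`.
-/

namespace QCarlitz

/-! ### `q`-integers -/

/-- The `q`-integer `[m] = 1 + q + ⋯ + q^{m-1}` in an arbitrary commutative ring. -/
def qNat {R : Type*} [CommRing R] (q : R) (m : ℕ) : R := ∑ i ∈ Finset.range m, q ^ i

section qNat

variable {R : Type*} [CommRing R] (q : R)

@[simp] lemma qNat_zero : qNat q 0 = 0 := by simp [qNat]

@[simp] lemma qNat_one : qNat q 1 = 1 := by simp [qNat]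

lemma qNat_add (m n : ℕ) : qNat q (m + n) = qNat q m + q ^ m * qNat q n := by
  simp only [qNat, Finset.sum_range_add, Finset.mul_sum, pow_add]

lemma qNat_succ (m : ℕ) : qNat q (m + 1) = qNat q m + q ^ m := by
  simp [qNat_add]

/-- Enumerating a finite set increasingly, the elements carry the exponents `0, 1, 2, …`. -/
lemma sum_pow_card_filter_lt (A : Finset ℕ) :
    ∑ i ∈ A, q ^ (A.filter (· < i)).card = qNat q A.card := by
  induction A using Finset.induction_on_max with
  | empty => simp
  | insert a s h ih =>
    have ha : a ∉ s := fun h' => (h a h').false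
    rw [Finset.sum_insert ha, Finset.card_insert_of_notMem ha, qNat_succ, ← ih, add_comm]
    congr 1
    · refine Finset.sum_congr rfl fun i hi => ?_
      rw [Finset.filter_insert, if_neg (h i hi).not_gt]
    · rw [Finset.filter_insert, if_neg (lt_irrefl a), Finset.filter_true_of_mem h]

/-- Enumerating a finite set decreasingly, the elements carry the exponents `1, 2, 3, …`. -/
lemma sum_pow_card_filter_ge (A : Finset ℕ) :
    ∑ i ∈ A, q ^ (A.filter (i ≤ ·)).card = q * qNat q A.card := by
  induction A using Finset.induction_on_min with
  | empty => simp
  | insert a s h ih =>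
    have ha : a ∉ s := fun h' => (h a h').false
    rw [Finset.sum_insert ha, Finset.card_insert_of_notMem ha, qNat_succ, mul_add, ← ih, add_comm]
    congr 1
    · refine Finset.sum_congr rfl fun i hi => ?_
      rw [Finset.filter_insert, if_neg (h i hi).not_ge]
    · rw [Finset.filter_insert, if_pos le_rfl, Finset.filter_true_of_mem fun x hx => (h x hx).le,
        Finset.card_insert_of_notMem ha, pow_succ, mul_comm]

end qNat

/-! ### Inserting the largest letter into a permutation -/

open PermStat

/-- The permutation of `Fin (m + 1)` whose word is that of `τ` with the new largest letter
inserted at position `p`. -/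
def insertMax {m : ℕ} (p : Fin (m + 1)) (τ : Equiv.Perm (Fin m)) : Equiv.Perm (Fin (m + 1)) :=
  ((finSuccEquiv' p).trans τ.optionCongr).trans (finSuccEquiv' (Fin.last m)).symm

section insertMax

variable {m : ℕ} (p : Fin (m + 1)) (τ : Equiv.Perm (Fin m))

@[simp] lemma insertMax_self : insertMax p τ p = Fin.last m := by
  simp [insertMax]

@[simp] lemma insertMax_succAbove (i : Fin m) :
    insertMax p τ (p.succAbove i) = (τ i).castSucc := by
  simp [insertMax]

lemma insertMax_bijective :
    Function.Bijective fun x : Fin (m + 1) × Equiv.Perm (Fin m) => insertMax x.1 x.2 := by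
  rw [Fintype.bijective_iff_injective_and_card]
  constructor
  · rintro ⟨p, τ⟩ ⟨p', τ'⟩ h
    simp only at h
    have hp : p = p' := by
      apply (insertMax p τ).injective
      rw [insertMax_self, h, insertMax_self]
    subst hp
    congr 1
    ext1 i
    have := congrArg (fun e => e (p.succAbove i)) h
    simpa using this
  · simp [Fintype.card_perm, Nat.factorial_succ]

lemma lrmin_insertMax : lrmin (insertMax p τ) = lrmin τ + if p = 0 then 1 else 0 := by
  unfold lrmin
  simp only [Finset.card_filter]
  rw [Fin.sum_univ_succAbove _ p, add_comm]
  congr 1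
  · refine Finset.sum_congr rfl fun i _ => ?_
    congr 1
    rw [Fin.forall_iff_succAbove p]
    simp [Fin.succAbove_lt_succAbove_iff, Fin.castSucc_lt_last]
  · congr 1
    simp only [insertMax_self, eq_iff_iff]
    constructor
    · intro h
      by_contra h0
      exact absurd (h 0 (Fin.pos_of_ne_zero h0)) (Fin.le_last _).not_gt
    · rintro rfl j hj
      exact absurd hj (Fin.zero_le j).not_gt

lemma rlmin_insertMax : rlmin (insertMax p τ) = rlmin τ + if p = Fin.last m then 1 else 0 := by
  unfold rlmin
  simp only [Finset.card_filter]
  rw [Fin.sum_univ_succAbove _ p, add_comm]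
  congr 1
  · refine Finset.sum_congr rfl fun i _ => ?_
    congr 1
    rw [Fin.forall_iff_succAbove p]
    simp [Fin.succAbove_lt_succAbove_iff, Fin.castSucc_lt_last]
  · congr 1
    simp only [insertMax_self, eq_iff_iff]
    constructor
    · intro h
      by_contra h0
      exact absurd (h (Fin.last m) (Fin.lt_last_iff_ne_last.2 h0)) (Fin.le_last _).not_gt
    · rintro rfl j hj
      exact absurd hj (Fin.le_last j).not_gt

end insertMax

lemma lrmin_pos {m : ℕ} (τ : Equiv.Perm (Fin (m + 1))) : 0 < lrmin τ :=
  Finset.card_pos.2 ⟨0, by simp⟩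

lemma rlmin_pos {m : ℕ} (τ : Equiv.Perm (Fin (m + 1))) : 0 < rlmin τ :=
  Finset.card_pos.2 ⟨Fin.last m, by simpa using fun j h => absurd h (Fin.le_last j).not_gt⟩

/-- The descents of a permutation as a set of natural numbers (zero-based positions). -/
def descNat {m : ℕ} (τ : Equiv.Perm (Fin m)) : Finset ℕ := (descents τ).map Fin.valEmbedding

lemma mem_descNat {m : ℕ} (τ : Equiv.Perm (Fin m)) (i : ℕ) :
    i ∈ descNat τ ↔ ∃ h : i + 1 < m, τ ⟨i + 1, h⟩ < τ ⟨i, by omega⟩ := by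
  simp only [descNat, descents, Finset.mem_map, Finset.mem_filter, Finset.mem_univ, true_and,
    Fin.valEmbedding_apply]
  constructor
  · rintro ⟨a, ⟨j, hj, hlt⟩, rfl⟩
    exact ⟨hj ▸ j.2, by convert hlt using 2; exact Fin.ext hj.symm⟩
  · rintro ⟨h, hlt⟩
    exact ⟨⟨i, by omega⟩, ⟨⟨i + 1, h⟩, rfl, hlt⟩, rfl⟩

lemma card_descNat {m : ℕ} (τ : Equiv.Perm (Fin m)) : (descNat τ).card = des τ := by
  simp [descNat, des]

lemma sum_descNat {m : ℕ} (τ : Equiv.Perm (Fin m)) : ∑ i ∈ descNat τ, (i + 1) = maj τ := by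
  simp [descNat, maj]

lemma descNat_subset {m : ℕ} (τ : Equiv.Perm (Fin (m + 1))) : descNat τ ⊆ Finset.range m := by
  intro i hi
  obtain ⟨h, -⟩ := (mem_descNat τ i).1 hi
  simpa using h

lemma des_le {m : ℕ} (τ : Equiv.Perm (Fin (m + 1))) : des τ ≤ m := by
  simpa [card_descNat] using Finset.card_le_card (descNat_subset τ)

/-- Descents strictly before the slot stay, those after it are shifted by one, a descent at the
slot disappears, and the new letter starts a descent unless it is the last one. -/
lemma mem_descNat_insertMax {m : ℕ} (p : Fin (m + 1)) (τ : Equiv.Perm (Fin m)) (i : ℕ) :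
    i ∈ descNat (insertMax p τ) ↔
      (i + 1 < p ∧ i ∈ descNat τ) ∨ (i = p ∧ i < m) ∨ ((p : ℕ) < i ∧ i - 1 ∈ descNat τ) := by
  have below : ∀ (j : ℕ) (hj : j < p), insertMax p τ ⟨j, by omega⟩ =
      (τ ⟨j, by omega⟩).castSucc := by
    intro j hj
    rw [← insertMax_succAbove p τ, Fin.succAbove_of_castSucc_lt _ _ (by simpa [Fin.lt_def])]
    rfl
  have above : ∀ (j : ℕ) (hj : p < j) (hm : j < m + 1), insertMax p τ ⟨j, hm⟩ =
      (τ ⟨j - 1, by omega⟩).castSucc := by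
    intro j hj hm
    rw [← insertMax_succAbove p τ, Fin.succAbove_of_le_castSucc _ _ (by simp [Fin.le_def]; omega)]
    congr 1
    ext
    simp; omega
  have at_p : ∀ (j : ℕ) (hj : j = p), insertMax p τ ⟨j, by omega⟩ = Fin.last m := by
    intro j hj
    subst hj
    exact insertMax_self p τ
  rw [mem_descNat, mem_descNat]
  rcases lt_trichotomy (i + 1) p with h | h | h
  · have hi : i + 1 < m := by omega
    simp only [below i (by omega), below (i + 1) h, Fin.castSucc_lt_castSucc_iff]
    have h1 : ¬ (i = p) := by omega
    have h2 : ¬ ((p : ℕ) < i) := by omega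
    simp [h, h1, h2, hi, hi.le]
  · have h1 : ¬ (i = p) := by omega
    have h2 : ¬ ((p : ℕ) < i) := by omega
    simp only [h1, h2, h, lt_irrefl, false_and, or_false, iff_false, not_exists]
    intro _ hlt
    rw [at_p _ rfl] at hlt
    exact (Fin.le_last _).not_gt hlt
  · rcases Nat.lt_or_ge p i with h' | h'
    · have h1 : ¬ (i = p) := by omega
      have h2 : ¬ (i + 1 < p) := by omega
      obtain ⟨j, rfl⟩ : ∃ j, i = j + 1 := ⟨i - 1, by omega⟩
      simp only [h1, h2, h', false_and, true_and, false_or, Nat.add_sub_cancel, mem_descNat]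
      constructor
      · rintro ⟨hm, hlt⟩
        rw [above _ h' (by omega), above _ h hm] at hlt
        exact ⟨by omega, by simpa using hlt⟩
      · rintro ⟨hm, hlt⟩
        refine ⟨by omega, ?_⟩
        rw [above _ h' (by omega), above _ h (by omega)]
        simpa using hlt
    · obtain rfl : i = p := by omega
      have h2 : ¬ ((p : ℕ) + 1 < p) := by omega
      simp only [h2, lt_irrefl, false_and, false_or, or_false, true_and]
      constructor
      · rintro ⟨hm, _⟩
        omega
      · intro hm
        refine ⟨by omega, ?_⟩
        rw [above _ (by omega) (by omega), at_p _ rfl]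
        exact Fin.castSucc_lt_last _

lemma sum_descNat_insertMax {m : ℕ} (p : Fin (m + 1)) (τ : Equiv.Perm (Fin m)) (f : ℕ → ℕ) :
    ∑ i ∈ descNat (insertMax p τ), f i =
      ∑ i ∈ descNat τ with i + 1 < (p : ℕ), f i + (if (p : ℕ) < m then f p else 0) +
        ∑ i ∈ descNat τ with (p : ℕ) ≤ i, f (i + 1) := by
  have key : descNat (insertMax p τ) = (descNat τ).filter (fun i => i + 1 < (p : ℕ)) ∪
      (if (p : ℕ) < m then {(p : ℕ)} else ∅) ∪
      ((descNat τ).filter (fun i => (p : ℕ) ≤ i)).image Nat.succ := by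
    ext i
    rw [mem_descNat_insertMax]
    have e1 : (i ∈ if (p : ℕ) < m then ({(p : ℕ)} : Finset ℕ) else ∅) ↔ i = p ∧ i < m := by
      split_ifs with h
      · simp only [Finset.mem_singleton]
        omega
      · simp only [Finset.notMem_empty, false_iff]
        omega
    have e2 : i ∈ ((descNat τ).filter (fun i => (p : ℕ) ≤ i)).image Nat.succ ↔
        (p : ℕ) < i ∧ i - 1 ∈ descNat τ := by
      simp only [Finset.mem_image, Finset.mem_filter]
      constructor
      · rintro ⟨j, ⟨hj, hp⟩, rfl⟩
        exact ⟨Nat.lt_succ_of_le hp, by simpa using hj⟩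
      · rintro ⟨hp, hj⟩
        exact ⟨i - 1, ⟨hj, by omega⟩, by simp; omega⟩
    rw [Finset.mem_union, Finset.mem_union, e1, e2, Finset.mem_filter, or_assoc]
    tauto
  rw [key, Finset.sum_union, Finset.sum_union, Finset.sum_image (by simp)]
  · congr 2
    split_ifs <;> simp
  · rw [Finset.disjoint_left]
    intro i hi
    split_ifs
    · simp only [Finset.mem_filter, Finset.mem_singleton] at hi ⊢
      omega
    · simp
  · rw [Finset.disjoint_left]
    intro i hi hi'
    simp only [Finset.mem_image, Finset.mem_filter] at hi'
    obtain ⟨j, ⟨-, hj⟩, rfl⟩ := hi'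
    rw [Finset.mem_union, Finset.mem_filter] at hi
    rcases hi with ⟨-, hi⟩ | hi
    · omega
    · split_ifs at hi
      · rw [Finset.mem_singleton] at hi
        omega
      · exact absurd hi (Finset.notMem_empty _)

section statistics

variable {n : ℕ} (τ : Equiv.Perm (Fin (n + 1)))

lemma des_insertMax_zero : des (insertMax 0 τ) = des τ + 1 := by
  have := sum_descNat_insertMax 0 τ (fun _ => 1)
  simp [card_descNat] at this
  omega

lemma maj_insertMax_zero : maj (insertMax 0 τ) = maj τ + (des τ + 1) := by
  rw [← sum_descNat, sum_descNat_insertMax, Finset.sum_add_distrib (f := fun i => i + 1)]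
  simp [sum_descNat, card_descNat]
  ring

lemma sum_descNat_insertMax_last (f : ℕ → ℕ) :
    ∑ i ∈ descNat (insertMax (Fin.last (n + 1)) τ), f i = ∑ i ∈ descNat τ, f i := by
  have hD : ∀ i ∈ descNat τ, i < n := fun i hi => by simpa using descNat_subset τ hi
  rw [sum_descNat_insertMax, Finset.filter_true_of_mem (fun i hi => by simp [hD i hi]),
    Finset.filter_false_of_mem (fun i hi => by have := hD i hi; simp; omega)]
  simp

lemma des_insertMax_last : des (insertMax (Fin.last (n + 1)) τ) = des τ := by
  simpa [card_descNat] using sum_descNat_insertMax_last τ (fun _ => 1)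

lemma maj_insertMax_last : maj (insertMax (Fin.last (n + 1)) τ) = maj τ := by
  simpa only [sum_descNat] using sum_descNat_insertMax_last τ (fun i => i + 1)

variable {τ}

lemma sum_descNat_insertMax_desc {j : Fin n} (hj : (j : ℕ) ∈ descNat τ) (f : ℕ → ℕ) :
    ∑ i ∈ descNat (insertMax j.castSucc.succ τ), f i =
      ∑ i ∈ descNat τ with i < (j : ℕ), f i + ∑ i ∈ descNat τ with (j : ℕ) ≤ i, f (i + 1) := by
  have e : (descNat τ).filter (fun i => (j : ℕ) ≤ i) =
      insert (j : ℕ) ((descNat τ).filter (fun i => (j : ℕ) + 1 ≤ i)) := by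
    ext i
    simp only [Finset.mem_filter, Finset.mem_insert]
    constructor
    · rintro ⟨h, h'⟩
      rcases h'.eq_or_lt with h'' | h''
      · exact Or.inl h''.symm
      · exact Or.inr ⟨h, h''⟩
    · rintro (rfl | ⟨h, h'⟩)
      · exact ⟨hj, le_rfl⟩
      · exact ⟨h, by omega⟩
  rw [sum_descNat_insertMax, e, Finset.sum_insert (by simp)]
  simp [add_assoc]

lemma sum_descNat_insertMax_asc {j : Fin n} (hj : (j : ℕ) ∉ descNat τ) (f : ℕ → ℕ) :
    ∑ i ∈ descNat (insertMax j.castSucc.succ τ), f i =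
      ∑ i ∈ descNat τ with i < (j : ℕ), f i + f (j + 1) + ∑ i ∈ descNat τ with (j : ℕ) ≤ i, f (i + 1) := by
  have e : (descNat τ).filter (fun i => (j : ℕ) ≤ i) =
      (descNat τ).filter (fun i => (j : ℕ) + 1 ≤ i) := by
    refine Finset.filter_congr fun i hi => ⟨fun h => ?_, fun h => by omega⟩
    rcases h.eq_or_lt with rfl | h
    · exact absurd hi hj
    · exact h
  rw [sum_descNat_insertMax, e]
  simp

lemma sum_filter_lt_add_sum_filter_ge (D : Finset ℕ) (j : ℕ) (f : ℕ → ℕ) :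
    ∑ i ∈ D with i < j, f i + ∑ i ∈ D with j ≤ i, f i = ∑ i ∈ D, f i := by
  simpa only [not_lt] using Finset.sum_filter_add_sum_filter_not D (· < j) f

lemma des_insertMax_desc {j : Fin n} (hj : (j : ℕ) ∈ descNat τ) :
    des (insertMax j.castSucc.succ τ) = des τ := by
  have h1 := sum_descNat_insertMax_desc hj (fun _ => 1)
  have h2 := sum_filter_lt_add_sum_filter_ge (descNat τ) j (fun _ => 1)
  simp only [← Finset.card_eq_sum_ones, card_descNat] at h1 h2
  omega

lemma maj_insertMax_desc {j : Fin n} (hj : (j : ℕ) ∈ descNat τ) :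
    maj (insertMax j.castSucc.succ τ) = maj τ + ((descNat τ).filter ((j : ℕ) ≤ ·)).card := by
  rw [← sum_descNat, ← sum_descNat, sum_descNat_insertMax_desc hj,
    ← sum_filter_lt_add_sum_filter_ge (descNat τ) j, add_assoc, Finset.card_eq_sum_ones,
    ← Finset.sum_add_distrib]

lemma des_insertMax_asc {j : Fin n} (hj : (j : ℕ) ∉ descNat τ) :
    des (insertMax j.castSucc.succ τ) = des τ + 1 := by
  have h1 := sum_descNat_insertMax_asc hj (fun _ => 1)
  have h2 := sum_filter_lt_add_sum_filter_ge (descNat τ) j (fun _ => 1)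
  simp only [← Finset.card_eq_sum_ones, card_descNat] at h1 h2
  omega

/-- The ascents before `j` account, together with the descents, for the shift of `maj`. -/
lemma maj_insertMax_asc {j : Fin n} (hj : (j : ℕ) ∉ descNat τ) :
    maj (insertMax j.castSucc.succ τ) =
      maj τ + (des τ + 2 + ((Finset.range n \ descNat τ).filter (· < (j : ℕ))).card) := by
  have h1 : maj (insertMax j.castSucc.succ τ) =
      maj τ + ((j + 2) + ((descNat τ).filter ((j : ℕ) ≤ ·)).card) := by
    rw [← sum_descNat, ← sum_descNat, sum_descNat_insertMax_asc hj,
      ← sum_filter_lt_add_sum_filter_ge (descNat τ) j, Finset.card_eq_sum_ones,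
      Finset.sum_add_distrib (f := fun i => i + 1)]
    ring
  have h2 := sum_filter_lt_add_sum_filter_ge (descNat τ) j (fun _ => 1)
  simp only [← Finset.card_eq_sum_ones, card_descNat] at h2
  have h3 : ((descNat τ).filter (· < (j : ℕ))).card +
      ((Finset.range n \ descNat τ).filter (· < (j : ℕ))).card = j := by
    rw [← Finset.card_union_of_disjoint, ← Finset.filter_union,
      Finset.union_sdiff_of_subset (descNat_subset τ)]
    · have : (Finset.range n).filter (· < (j : ℕ)) = Finset.range j := by
        ext i
        simp only [Finset.mem_filter, Finset.mem_range]
        omega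
      rw [this, Finset.card_range]
    · exact Finset.disjoint_filter_filter Finset.disjoint_sdiff
  omega

end statistics

/-! ### The generating function and its recurrence -/

section weight

variable {K : Type*} [Field K] (a b x y q : K)

/-- The weight of a permutation, where `a`, `b`, `x`, `y` stand for `[α]`, `[β]`, `q^(α-1)`,
`q^(β-1)` and are treated as independent parameters. -/
def weight {m : ℕ} (σ : Equiv.Perm (Fin m)) : K :=
  a ^ (lrmin σ - 1) * b ^ (rlmin σ - 1) * x ^ (1 + (des σ : ℤ) - lrmin σ) *
    y ^ ((m : ℤ) - rlmin σ) * q ^ maj σ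

/-- The weight generating function of the permutations of `n + 1` letters with `k` descents. -/
def weightSum (n k : ℕ) : K :=
  ∑ σ : Equiv.Perm (Fin (n + 1)) with des σ = k, weight a b x y q σ

variable {x y} {n : ℕ}

lemma weight_insertMax_zero (hy : y ≠ 0) (τ : Equiv.Perm (Fin (n + 1))) :
    weight a b x y q (insertMax 0 τ) = weight a b x y q τ * (a * y * q ^ (des τ + 1)) := by
  have hl := lrmin_pos τ
  obtain ⟨l, hl⟩ : ∃ l, lrmin τ = l + 1 := ⟨lrmin τ - 1, by omega⟩
  have h0 : (0 : Fin (n + 1 + 1)) ≠ Fin.last (n + 1) := by simp [Fin.ext_iff]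
  simp only [weight, lrmin_insertMax, rlmin_insertMax, des_insertMax_zero, maj_insertMax_zero,
    if_true, if_neg h0, hl]
  have e1 : 1 + ((des τ + 1 : ℕ) : ℤ) - ((l + 1 + 1 : ℕ) : ℤ) =
      1 + (des τ : ℤ) - ((l + 1 : ℕ) : ℤ) := by push_cast; ring
  have e2 : ((n + 1 + 1 : ℕ) : ℤ) - ((rlmin τ + 0 : ℕ) : ℤ) =
      ((n + 1 : ℕ) : ℤ) - (rlmin τ : ℤ) + 1 := by push_cast; ring
  rw [e1, e2, zpow_add_one₀ hy, Nat.add_sub_cancel, Nat.add_sub_cancel, pow_add q, pow_succ a]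
  simp only [add_zero]
  ring

lemma weight_insertMax_last (τ : Equiv.Perm (Fin (n + 1))) :
    weight a b x y q (insertMax (Fin.last (n + 1)) τ) = weight a b x y q τ * b := by
  have hr := rlmin_pos τ
  obtain ⟨r, hr⟩ : ∃ r, rlmin τ = r + 1 := ⟨rlmin τ - 1, by omega⟩
  have h0 : Fin.last (n + 1) ≠ (0 : Fin (n + 1 + 1)) := by simp [Fin.ext_iff]
  simp only [weight, lrmin_insertMax, rlmin_insertMax, des_insertMax_last, maj_insertMax_last,
    if_true, if_neg h0, hr]
  have e2 : ((n + 1 + 1 : ℕ) : ℤ) - ((r + 1 + 1 : ℕ) : ℤ) =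
      ((n + 1 : ℕ) : ℤ) - ((r + 1 : ℕ) : ℤ) := by push_cast; ring
  rw [e2, Nat.add_sub_cancel, Nat.add_sub_cancel, pow_succ b]
  simp only [add_zero]
  ring

lemma castSucc_succ_ne (j : Fin n) :
    j.castSucc.succ ≠ 0 ∧ j.castSucc.succ ≠ Fin.last (n + 1) := by
  simp only [ne_eq, Fin.ext_iff]
  simp
  omega

lemma weight_insertMax_desc (hy : y ≠ 0) {τ : Equiv.Perm (Fin (n + 1))} {j : Fin n}
    (hj : (j : ℕ) ∈ descNat τ) :
    weight a b x y q (insertMax j.castSucc.succ τ) =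
      weight a b x y q τ * y * q ^ ((descNat τ).filter ((j : ℕ) ≤ ·)).card := by
  simp only [weight, lrmin_insertMax, rlmin_insertMax, des_insertMax_desc hj,
    maj_insertMax_desc hj, if_neg (castSucc_succ_ne j).1, if_neg (castSucc_succ_ne j).2, add_zero]
  have e2 : ((n + 1 + 1 : ℕ) : ℤ) - (rlmin τ : ℤ) =
      ((n + 1 : ℕ) : ℤ) - (rlmin τ : ℤ) + 1 := by push_cast; ring
  rw [e2, zpow_add_one₀ hy, pow_add q]
  ring

lemma weight_insertMax_asc (hx : x ≠ 0) (hy : y ≠ 0) {τ : Equiv.Perm (Fin (n + 1))} {j : Fin n}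
    (hj : (j : ℕ) ∉ descNat τ) :
    weight a b x y q (insertMax j.castSucc.succ τ) =
      weight a b x y q τ * (x * y * q ^ (des τ + 2)) *
        q ^ ((Finset.range n \ descNat τ).filter (· < (j : ℕ))).card := by
  simp only [weight, lrmin_insertMax, rlmin_insertMax, des_insertMax_asc hj,
    maj_insertMax_asc hj, if_neg (castSucc_succ_ne j).1, if_neg (castSucc_succ_ne j).2, add_zero]
  have e1 : 1 + ((des τ + 1 : ℕ) : ℤ) - (lrmin τ : ℤ) =
      1 + (des τ : ℤ) - (lrmin τ : ℤ) + 1 := by push_cast; ring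
  have e2 : ((n + 1 + 1 : ℕ) : ℤ) - (rlmin τ : ℤ) =
      ((n + 1 : ℕ) : ℤ) - (rlmin τ : ℤ) + 1 := by push_cast; ring
  rw [e1, e2, zpow_add_one₀ hy, zpow_add_one₀ hx, pow_add q, pow_add q (des τ + 2)]
  ring

/-- The contribution of all insertions of the largest letter into a fixed permutation. -/
lemma sum_weight_insertMax (hx : x ≠ 0) (hy : y ≠ 0) (τ : Equiv.Perm (Fin (n + 1))) (k : ℕ) :
    ∑ p, (if des (insertMax p τ) = k then weight a b x y q (insertMax p τ) else 0) =
      (if des τ = k then weight a b x y q τ * (b + y * q * qNat q (des τ)) else 0) +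
      (if des τ + 1 = k then weight a b x y q τ *
        (y * q ^ (des τ + 1) * (a + x * q * qNat q (n - des τ))) else 0) := by
  classical
  rw [Fin.sum_univ_succ, Fin.sum_univ_castSucc, Fin.succ_last]
  let F : ℕ → K := fun i =>
    if i ∈ descNat τ then
      (if des τ = k then weight a b x y q τ * y *
        q ^ ((descNat τ).filter (i ≤ ·)).card else 0)
    else (if des τ + 1 = k then weight a b x y q τ * (x * y * q ^ (des τ + 2)) *
      q ^ ((Finset.range n \ descNat τ).filter (· < i)).card else 0)
  have mid : ∀ j : Fin n,
      (if des (insertMax j.castSucc.succ τ) = k then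
        weight a b x y q (insertMax j.castSucc.succ τ) else 0) = F j := by
    intro j
    by_cases hj : (j : ℕ) ∈ descNat τ
    · simp only [F, hj, if_true, des_insertMax_desc hj, weight_insertMax_desc a b q hy hj]
    · simp only [F, hj, if_false, des_insertMax_asc hj, weight_insertMax_asc a b q hx hy hj]
  rw [Finset.sum_congr rfl fun j _ => mid j, Fin.sum_univ_eq_sum_range F n, Finset.sum_ite,
    Finset.filter_mem_eq_inter, Finset.inter_eq_right.2 (descNat_subset τ),
    Finset.filter_notMem_eq_sdiff]
  have hc : (Finset.range n \ descNat τ).card = n - des τ := by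
    rw [Finset.card_sdiff_of_subset (descNat_subset τ), Finset.card_range, card_descNat]
  rw [des_insertMax_zero, des_insertMax_last, weight_insertMax_zero a b q hy,
    weight_insertMax_last]
  have s1 := sum_pow_card_filter_ge q (descNat τ)
  have s2 := sum_pow_card_filter_lt q (Finset.range n \ descNat τ)
  rw [hc] at s2
  rw [card_descNat] at s1
  by_cases h1 : des τ = k
  · have h2 : ¬ des τ + 1 = k := by omega
    simp only [h1, if_true, ← Finset.mul_sum]
    rw [s1, h1]
    simp
    ring
  · by_cases h2 : des τ + 1 = k
    · simp only [h1, if_true, h2, if_false, ← Finset.mul_sum, Finset.sum_const_zero]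
      rw [s2, ← h2]
      ring
    · simp [h1, h2]

lemma weightSum_succ (hx : x ≠ 0) (hy : y ≠ 0) (n k : ℕ) :
    weightSum a b x y q (n + 1) k =
      ∑ τ : Equiv.Perm (Fin (n + 1)),
      ((if des τ = k then weight a b x y q τ * (b + y * q * qNat q (des τ)) else 0) +
      (if des τ + 1 = k then weight a b x y q τ *
        (y * q ^ (des τ + 1) * (a + x * q * qNat q (n - des τ))) else 0)) := by
  rw [weightSum, Finset.sum_filter, ← insertMax_bijective.sum_comp, Fintype.sum_prod_type_right]
  exact Finset.sum_congr rfl fun τ _ => sum_weight_insertMax a b q hx hy τ k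

lemma weightSum_succ_zero (hx : x ≠ 0) (hy : y ≠ 0) (n : ℕ) :
    weightSum a b x y q (n + 1) 0 = b * weightSum a b x y q n 0 := by
  rw [weightSum_succ a b q hx hy, weightSum, Finset.sum_filter, Finset.mul_sum]
  refine Finset.sum_congr rfl fun τ _ => ?_
  by_cases h : des τ = 0
  · simp [h, mul_comm]
  · simp [h]

lemma weightSum_succ_succ (hx : x ≠ 0) (hy : y ≠ 0) (n k : ℕ) :
    weightSum a b x y q (n + 1) (k + 1) =
      y * q ^ (k + 1) * (a + x * q * qNat q (n - k)) * weightSum a b x y q n k +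
        (b + y * q * qNat q (k + 1)) * weightSum a b x y q n (k + 1) := by
  rw [weightSum_succ a b q hx hy, Finset.sum_add_distrib, add_comm]
  simp only [weightSum, Finset.sum_filter, Finset.mul_sum, add_left_inj]
  congr 1
  · refine Finset.sum_congr rfl fun τ _ => ?_
    by_cases h : des τ = k
    · simp [h, mul_comm]
    · simp [h]
  · refine Finset.sum_congr rfl fun τ _ => ?_
    by_cases h : des τ = k + 1
    · simp [h, mul_comm]
    · simp [h]

lemma weightSum_eq_zero {n k : ℕ} (h : n < k) : weightSum a b x y q n k = 0 := by
  rw [weightSum, Finset.filter_false_of_mem, Finset.sum_empty]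
  intro τ _
  have := des_le τ
  omega

lemma weightSum_zero_zero : weightSum a b x y q 0 0 = 1 := by
  have h (σ : Equiv.Perm (Fin 1)) : des σ = 0 := by simpa using des_le σ
  have hl : lrmin (1 : Equiv.Perm (Fin 1)) = 1 := by decide
  have hr : rlmin (1 : Equiv.Perm (Fin 1)) = 1 := by decide
  have hm : maj (1 : Equiv.Perm (Fin 1)) = 0 := by decide
  simp [weightSum, h, weight, hl, hr, hm]

end weight

/-! ### The Dirichlet problem for a biased walk on the integers -/

section Dirichlet

variable {K : Type} [Field K] (q : K)

/-- The operator on functions `ℤ → W` modelled on the Klyachko relation: its zeros are the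
functions that are harmonic for the walk stepping left and right with weights `q` and `1`. -/
def lap {W : Type} [AddCommGroup W] [Module K W] (h : ℤ → W) (p : ℤ) : W :=
  (1 + q) • h p - q • h (p - 1) - h (p + 1)

variable {q} {W : Type} [AddCommGroup W] [Module K W]

lemma lap_sub (f g : ℤ → W) (p : ℤ) : lap q (fun p => f p - g p) p = lap q f p - lap q g p := by
  simp only [lap, smul_sub]
  abel

lemma lap_map {W' : Type} [AddCommGroup W'] [Module K W'] (T : W →ₗ[K] W') (f : ℤ → W) (p : ℤ) :
    lap q (fun p => T (f p)) p = T (lap q f p) := by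
  simp [lap]

/-- A harmonic function with zero boundary values vanishes: from the leftmost point `i` where it
does not, it would continue as `h (i + t) = [t + 1] h i` for ever. -/
lemma eq_zero_of_lap_eq_zero (hq : ∀ m, qNat q (m + 1) ≠ 0) (S : Finset ℤ) (h : ℤ → W)
    (h0 : ∀ p ∉ S, h p = 0) (hh : ∀ p ∈ S, lap q h p = 0) (p : ℤ) : h p = 0 := by
  classical
  by_contra hp
  have hT : (S.filter (fun i => h i ≠ 0)).Nonempty :=
    ⟨p, Finset.mem_filter.2 ⟨by_contra fun hS => hp (h0 p hS), hp⟩⟩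
  obtain ⟨i, hi, hmin⟩ := Finset.exists_min_image _ id hT
  have hi0 : h i ≠ 0 := (Finset.mem_filter.1 hi).2
  have hprev : h (i - 1) = 0 := by
    by_contra hne
    have := hmin (i - 1) (Finset.mem_filter.2 ⟨by_contra fun hS => hne (h0 _ hS), hne⟩)
    simp at this
  have mem : ∀ t : ℕ, h (i + t) = qNat q (t + 1) • h i → i + t ∈ S := fun t ht => by
    by_contra hS
    rw [h0 _ hS] at ht
    exact (smul_ne_zero (hq t) hi0) ht.symm
  have key : ∀ t : ℕ, h (i + t) = qNat q (t + 1) • h i ∧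
      h (i + t + 1) = qNat q (t + 2) • h i := by
    intro t
    induction t with
    | zero =>
      have h1 := hh i (Finset.mem_filter.1 hi).1
      refine ⟨by simp, ?_⟩
      rw [lap, hprev, smul_zero, sub_zero, sub_eq_zero] at h1
      simp [← h1, qNat_succ]
    | succ t ih =>
      obtain ⟨ih1, ih2⟩ := ih
      have e : i + ((t + 1 : ℕ) : ℤ) = i + t + 1 := by push_cast; ring
      rw [e]
      refine ⟨ih2, ?_⟩
      have hS : i + t + 1 ∈ S := by
        have := mem (t + 1) (by rw [e]; exact ih2)
        rwa [e] at this
      have h1 := hh _ hS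
      rw [lap, sub_eq_zero, ih2, add_sub_cancel_right, ih1, smul_smul, smul_smul, ← sub_smul] at h1
      rw [← h1]
      congr 1
      simp only [qNat_succ]
      ring
  have hinj : Function.Injective fun t : ℕ => i + (t : ℤ) := fun a b hab => by simpa using hab
  exact (Set.infinite_of_injective_forall_mem (s := (S : Set ℤ)) hinj
    fun t => mem t (key t).1) S.finite_toSet

/-- Boundary values off a finite set extend harmonically to that set, and the extension stays in
any submodule containing them. One point is added to the set at a time: the value there can be
adjusted because the harmonic function with boundary value `1` at that point has, by uniqueness,
a nonzero `lap` there. -/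
lemma exists_lap_eq_zero (hq : ∀ m, qNat q (m + 1) ≠ 0) (S : Finset ℤ) (c : ℤ → W) :
    ∃ h : ℤ → W, (∀ p ∉ S, h p = c p) ∧ (∀ p ∈ S, lap q h p = 0) ∧
      ∀ N : Submodule K W, (∀ p ∉ S, c p ∈ N) → ∀ p, h p ∈ N := by
  classical
  induction S using Finset.induction_on generalizing W with
  | empty => exact ⟨c, by simp, by simp, fun N hN p => hN p (by simp)⟩
  | insert s S hs ih =>
    obtain ⟨f, f1, f2, f3⟩ := ih (fun p => if p = s then 0 else c p)
    obtain ⟨g, g1, g2, -⟩ := ih (W := K) (fun p => if p = s then 1 else 0)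
    have gs : g s = 1 := by rw [g1 s hs, if_pos rfl]
    have hg : lap q g s ≠ 0 := by
      intro h0
      have := eq_zero_of_lap_eq_zero hq (insert s S) g
        (fun p hp => by
          rw [Finset.mem_insert, not_or] at hp
          rw [g1 p hp.2, if_neg hp.1])
        (fun p hp => by
          rcases Finset.mem_insert.1 hp with rfl | hp
          · exact h0
          · exact g2 p hp) s
      exact one_ne_zero (gs.symm.trans this)
    have fN : ∀ N : Submodule K W, (∀ p ∉ insert s S, c p ∈ N) → ∀ p, f p ∈ N := by
      intro N hN
      refine f3 N fun p hp => ?_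
      split_ifs with h
      · exact N.zero_mem
      · exact hN p (by simp [h, hp])
    have hlin : ∀ (w : W) (p : ℤ),
        lap q (fun p => f p - g p • w) p = lap q f p - lap q g p • w := by
      intro w p
      rw [lap_sub, show (fun p => g p • w) = fun p => LinearMap.toSpanSingleton K W w (g p) from rfl,
        lap_map]
      rfl
    refine ⟨fun p => f p - g p • ((lap q g s)⁻¹ • lap q f s), ?_, ?_, ?_⟩
    · intro p hp
      rw [Finset.mem_insert, not_or] at hp
      simp only [f1 p hp.2, g1 p hp.2, if_neg hp.1, zero_smul, sub_zero]
    · intro p hp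
      rw [hlin]
      rcases Finset.mem_insert.1 hp with rfl | hp
      · rw [smul_smul, mul_inv_cancel₀ hg, one_smul, sub_self]
      · rw [f2 p hp, g2 p hp, zero_smul, sub_zero]
    · intro N hN p
      have hf := fN N hN
      refine N.sub_mem (hf p) (N.smul_mem _ (N.smul_mem _ ?_))
      exact N.sub_mem (N.sub_mem (N.smul_mem _ (hf _)) (N.smul_mem _ (hf _))) (hf _)

end Dirichlet

/-! ### Commuting operators satisfying the Klyachko relations -/

section Representation

variable {K : Type} [Field K] {q : K} (hq : ∀ m, qNat q (m + 1) ≠ 0) (r : ℕ)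

/-- Formal combinations of finite sets of occupied sites of `ℤ`. -/
abbrev States (K : Type) [Field K] : Type := Finset ℤ →₀ K

/-- The state obtained from `S` by occupying the site `g`; sites outside `{1, …, r}` absorb. -/
noncomputable def occupy (K : Type) [Field K] (S : Finset ℤ) (g : ℤ) : States K :=
  if 1 ≤ g ∧ g ≤ r then Finsupp.single (insert g S) 1 else 0

/-- The result of dropping a particle at `p` on the occupied set `S`: it walks on `S` until it
finds a free site. States that are not contained in `{1, …, r}` are sent to `0`. -/
noncomputable def drop (S : Finset ℤ) : ℤ → States K :=
  if S ⊆ Finset.Icc 1 (r : ℤ) then (exists_lap_eq_zero hq S (occupy r K S)).choose else 0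

/-- The linear operator dropping a particle at `p`. -/
noncomputable def dropOp (p : ℤ) : States K →ₗ[K] States K :=
  Finsupp.linearCombination K fun S => drop hq r S p

lemma dropOp_single (p : ℤ) (S : Finset ℤ) :
    dropOp hq r p (Finsupp.single S 1) = drop hq r S p := by
  simp [dropOp]

variable {r}

lemma drop_of_not_subset {S : Finset ℤ} (hS : ¬ S ⊆ Finset.Icc 1 (r : ℤ)) (p : ℤ) :
    drop hq r S p = 0 := by
  simp [drop, hS]

lemma drop_of_notMem {S : Finset ℤ} (hS : S ⊆ Finset.Icc 1 (r : ℤ)) {p : ℤ} (hp : p ∉ S) :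
    drop hq r S p = occupy r K S p := by
  rw [drop, if_pos hS]
  exact (exists_lap_eq_zero hq S (occupy r K S)).choose_spec.1 p hp

lemma lap_drop {S : Finset ℤ} {p : ℤ} (hp : p ∈ S) : lap q (drop hq r S) p = 0 := by
  by_cases hS : S ⊆ Finset.Icc 1 (r : ℤ)
  · rw [drop, if_pos hS]
    exact (exists_lap_eq_zero hq S (occupy r K S)).choose_spec.2.1 p hp
  · simp [drop, hS, lap]

lemma drop_mem {S : Finset ℤ} (N : Submodule K (States K)) (hN : ∀ p ∉ S, occupy r K S p ∈ N)
    (p : ℤ) : drop hq r S p ∈ N := by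
  by_cases hS : S ⊆ Finset.Icc 1 (r : ℤ)
  · rw [drop, if_pos hS]
    exact (exists_lap_eq_zero hq S (occupy r K S)).choose_spec.2.2 N hN p
  · simp [drop, hS]

/-- The combinations of sets containing `p` satisfy the Klyachko relation at `p`. -/
lemma lap_dropOp_of_mem {p : ℤ} {w : States K}
    (hw : w ∈ Submodule.span K {w : States K | ∃ S, p ∈ S ∧ w = Finsupp.single S 1}) :
    lap q (fun p => dropOp hq r p w) p = 0 := by
  induction hw using Submodule.span_induction with
  | mem w h =>
    obtain ⟨S, hS, rfl⟩ := h
    simp only [dropOp_single]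
    exact lap_drop hq hS
  | zero => simp [lap]
  | add x y _ _ hx hy =>
    have : lap q (fun p => dropOp hq r p (x + y)) p =
        lap q (fun p => dropOp hq r p x) p + lap q (fun p => dropOp hq r p y) p := by
      simp only [lap, map_add, smul_add]
      abel
    rw [this, hx, hy, add_zero]
  | smul c x _ hx =>
    have : lap q (fun p => dropOp hq r p (c • x)) p =
        c • lap q (fun p => dropOp hq r p x) p := by
      simp only [lap, map_smul, smul_sub, smul_comm c]
    rw [this, hx, smul_zero]

/-- After a particle is dropped, every site that was occupied still is. -/
lemma drop_mem_span {S : Finset ℤ} {p : ℤ} (hp : p ∈ S) (p' : ℤ) :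
    drop hq r S p' ∈ Submodule.span K {w : States K | ∃ S, p ∈ S ∧ w = Finsupp.single S 1} := by
  refine drop_mem hq _ (fun g _ => ?_) p'
  rw [occupy]
  split_ifs
  · exact Submodule.subset_span ⟨_, Finset.mem_insert_of_mem hp, rfl⟩
  · exact Submodule.zero_mem _

/-- The site on which a particle is dropped is occupied afterwards. -/
lemma drop_self_mem_span (S : Finset ℤ) (p : ℤ) :
    drop hq r S p ∈ Submodule.span K {w : States K | ∃ S, p ∈ S ∧ w = Finsupp.single S 1} := by
  by_cases hp : p ∈ S
  · exact drop_mem_span hq hp p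
  by_cases hS : S ⊆ Finset.Icc 1 (r : ℤ)
  · rw [drop_of_notMem hq hS hp, occupy]
    split_ifs
    · exact Submodule.subset_span ⟨_, Finset.mem_insert_self _ _, rfl⟩
    · exact Submodule.zero_mem _
  · rw [drop_of_not_subset hq hS]
    exact Submodule.zero_mem _

lemma dropOp_occupy {S : Finset ℤ} (hS : S ⊆ Finset.Icc 1 (r : ℤ)) {g g' : ℤ} (hg' : g' ∉ S)
    (hne : g' ≠ g) :
    dropOp hq r g' (occupy r K S g) =
      if (1 ≤ g ∧ g ≤ r) ∧ (1 ≤ g' ∧ g' ≤ r) then Finsupp.single (insert g (insert g' S)) 1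
      else 0 := by
  rw [occupy]
  by_cases h : 1 ≤ g ∧ g ≤ r
  · rw [if_pos h, dropOp_single, drop_of_notMem hq
      (Finset.insert_subset (Finset.mem_Icc.2 h) hS) (by simp [hne, hg']), occupy]
    simp only [h, true_and, Finset.insert_comm g g']
  · rw [if_neg h, map_zero, if_neg fun h' => h h'.1]

/-- The order in which two particles are dropped is irrelevant: the difference of the two orders
is harmonic in each of the two sites separately and vanishes on the boundary. -/
lemma dropOp_comm (p p' : ℤ) : dropOp hq r p * dropOp hq r p' = dropOp hq r p' * dropOp hq r p := by
  refine Finsupp.lhom_ext' fun S => LinearMap.ext_ring ?_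
  simp only [LinearMap.comp_apply, Finsupp.lsingle_apply, Module.End.mul_apply, dropOp_single]
  by_cases hS : S ⊆ Finset.Icc 1 (r : ℤ)
  swap
  · simp [drop_of_not_subset hq hS]
  rw [← sub_eq_zero]
  have inner : ∀ (s t : ℤ), t ∈ S →
      lap q (fun t => dropOp hq r s (drop hq r S t) - dropOp hq r t (drop hq r S s)) t = 0 := by
    intro s t ht
    rw [lap_sub, lap_map, lap_drop hq ht, map_zero, lap_dropOp_of_mem hq (drop_mem_span hq ht s),
      sub_zero]
  have boundary : ∀ s ∉ S, ∀ t,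
      dropOp hq r s (drop hq r S t) - dropOp hq r t (drop hq r S s) = 0 := by
    intro s hs
    refine eq_zero_of_lap_eq_zero hq S _ (fun t ht => ?_) (inner s)
    rcases eq_or_ne s t with rfl | hst
    · exact sub_self _
    · rw [drop_of_notMem hq hS hs, drop_of_notMem hq hS ht, dropOp_occupy hq hS hs hst,
        dropOp_occupy hq hS ht hst.symm, Finset.insert_comm]
      simp only [and_comm, sub_self]
  refine eq_zero_of_lap_eq_zero hq S (fun t => dropOp hq r p (drop hq r S t) -
    dropOp hq r t (drop hq r S p)) (fun t ht => ?_) (inner p) p'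
  rw [← neg_sub, boundary t ht p, neg_zero]

/-- The operators satisfy the Klyachko relations at every site. -/
lemma dropOp_relation (p : ℤ) :
    (1 + q) • dropOp hq r p ^ 2 =
      q • (dropOp hq r p * dropOp hq r (p - 1)) + dropOp hq r p * dropOp hq r (p + 1) := by
  rw [dropOp_comm hq p (p - 1), dropOp_comm hq p (p + 1)]
  refine Finsupp.lhom_ext' fun S => LinearMap.ext_ring ?_
  have := lap_dropOp_of_mem hq (r := r) (drop_self_mem_span hq (r := r) S p)
  simp only [lap, sub_sub, sub_eq_zero] at this
  simpa [pow_two, dropOp_single] using this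

/-- The sites `0` and `r + 1` absorb. -/
lemma dropOp_eq_zero {p : ℤ} (hp : ¬ (1 ≤ p ∧ p ≤ r)) : dropOp hq r p = 0 := by
  refine Finsupp.lhom_ext' fun S => LinearMap.ext_ring ?_
  simp only [LinearMap.comp_apply, Finsupp.lsingle_apply, dropOp_single, LinearMap.zero_apply]
  by_cases hS : S ⊆ Finset.Icc 1 (r : ℤ)
  · rw [drop_of_notMem hq hS fun h => hp (Finset.mem_Icc.1 (hS h)), occupy, if_neg hp]
  · rw [drop_of_not_subset hq hS]

end Representation

/-! ### The top monomial of the Klyachko algebra does not vanish -/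

open RemixedEulerian

lemma qInt_succ_ne_zero (m : ℕ) : qNat RemixedEulerian.q (m + 1) ≠ 0 := by
  have h : qNat RemixedEulerian.q (m + 1) =
      algebraMap (Polynomial ℚ) (RatFunc ℚ) (∑ i ∈ Finset.range (m + 1), Polynomial.X ^ i) := by
    simp [qNat, RemixedEulerian.q]
  rw [h]
  intro h0
  have h1 := (map_eq_zero_iff _ (RatFunc.algebraMap_injective ℚ)).1 h0
  have h2 := congrArg (Polynomial.eval 1) h1
  simp [Polynomial.eval_finsetSum] at h2
  norm_cast at h2

open scoped IsMulCommutative in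
/-- Dropping one particle on each of the sites `1, …, r` fills them, so `u₁ ⋯ u_r` acts on the
empty state in a nonzero way. -/
lemma mono_one_ne_zero (r : ℕ) : mono r (fun _ => 1) ≠ 0 := by
  classical
  let T : ℤ → Module.End Kq (States Kq) := dropOp qInt_succ_ne_zero r
  have hcomm : ∀ a ∈ Set.range T, ∀ b ∈ Set.range T, a * b = b * a := by
    rintro _ ⟨p, rfl⟩ _ ⟨p', rfl⟩
    exact dropOp_comm _ p p'
  have : IsMulCommutative (Algebra.adjoin Kq (Set.range T)) :=
    Algebra.isMulCommutative_adjoin Kq hcomm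
  let t : ℤ → Algebra.adjoin Kq (Set.range T) := fun p =>
    ⟨T p, Algebra.subset_adjoin (Set.mem_range_self p)⟩
  let φ : MvPolynomial (Fin r) Kq →ₐ[Kq] Algebra.adjoin Kq (Set.range T) :=
    MvPolynomial.aeval fun i => t ((i : ℕ) + 1)
  have hX : ∀ i : Fin r, φ (MvPolynomial.X i) = t ((i : ℕ) + 1) := fun i =>
    MvPolynomial.aeval_X _ i
  have hu : ∀ j : ℕ, φ (u r j) = t j := by
    intro j
    by_cases hj : 1 ≤ j ∧ j ≤ r
    · rw [u, dif_pos hj, hX]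
      congr 1
      have := hj.1
      push_cast [this]
      ring
    · rw [u, dif_neg hj, map_zero]
      refine Subtype.ext (dropOp_eq_zero _ fun h => hj ?_).symm
      exact_mod_cast h
  have hker : relations r ≤ RingHom.ker φ := by
    rw [relations, Ideal.span_le]
    rintro _ ⟨j, hj, hjr, rfl⟩
    rw [SetLike.mem_coe, RingHom.mem_ker, ← MvPolynomial.algebraMap_eq, mul_assoc,
      ← Algebra.smul_def, ← Algebra.smul_def, map_sub, sub_eq_zero, map_smul, map_pow, map_add,
      map_smul, map_mul, map_mul, hu, hu, hu]
    apply Subtype.ext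
    have := dropOp_relation qInt_succ_ne_zero (r := r) j
    have e1 : ((j - 1 : ℕ) : ℤ) = (j : ℤ) - 1 := by push_cast [hj]; ring
    have e2 : ((j + 1 : ℕ) : ℤ) = (j : ℤ) + 1 := by push_cast; ring
    rw [e1, e2]
    exact this
  intro h0
  rw [mono, Ideal.Quotient.eq_zero_iff_mem] at h0
  have h1 := hker h0
  rw [RingHom.mem_ker, map_prod] at h1
  have h2 : ∀ s : Finset (Fin r),
      ((∏ i ∈ s, φ (MvPolynomial.X i ^ 1) : Algebra.adjoin Kq (Set.range T)) :
        Module.End Kq (States Kq)) (Finsupp.single ∅ 1) =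
      Finsupp.single (s.image fun i : Fin r => ((i : ℕ) : ℤ) + 1) 1 := by
    intro s
    induction s using Finset.induction_on with
    | empty => rfl
    | insert i s hi ih =>
      rw [Finset.prod_insert hi]
      have : ((φ (MvPolynomial.X i ^ 1) * ∏ i ∈ s, φ (MvPolynomial.X i ^ 1) :
          Algebra.adjoin Kq (Set.range T)) : Module.End Kq (States Kq)) (Finsupp.single ∅ 1) =
          T ((i : ℕ) + 1) (((∏ i ∈ s, φ (MvPolynomial.X i ^ 1) :
            Algebra.adjoin Kq (Set.range T)) : Module.End Kq (States Kq))
              (Finsupp.single ∅ 1)) := by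
        rw [pow_one, hX]
        rfl
      rw [this, ih]
      have hsub : (s.image fun i : Fin r => ((i : ℕ) : ℤ) + 1) ⊆ Finset.Icc 1 (r : ℤ) := by
        intro z hz
        obtain ⟨a, -, rfl⟩ := Finset.mem_image.1 hz
        rw [Finset.mem_Icc]
        omega
      have hni : ((i : ℕ) : ℤ) + 1 ∉ s.image fun i : Fin r => ((i : ℕ) : ℤ) + 1 := by
        intro hz
        obtain ⟨a, ha, he⟩ := Finset.mem_image.1 hz
        have : a = i := Fin.ext (by omega)
        exact hi (this ▸ ha)
      rw [dropOp_single, drop_of_notMem _ hsub hni, occupy, if_pos (by omega),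
        Finset.image_insert]
  have h3 := h2 Finset.univ
  rw [h1] at h3
  exact one_ne_zero (Finsupp.single_eq_zero.1 h3.symm)

lemma remixed_eq {c : List ℕ} {a : Kq}
    (h : qFactorial c.length • mono c.length c.get = a • mono c.length (fun _ => 1)) :
    remixed c = a := by
  have h1 : qFactorial c.length • mono c.length c.get =
      remixed c • mono c.length (fun _ => 1) :=
    Classical.epsilon_spec
      (p := fun a : Kq => qFactorial c.length • mono c.length c.get = a • mono c.length fun _ => 1)
      ⟨a, h⟩
  rw [h] at h1
  exact (smul_left_injective Kq (mono_one_ne_zero c.length) h1).symm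

/-! ### Expanding a power times an interval monomial -/

section Expansion

variable {K : Type} [Field K] {q : K}

/-- Solutions of the second-order recurrence behind the Klyachko relation are interpolated from
their two boundary values with `q`-integer weights. -/
lemma qNat_smul_eq_of_recurrence {M : Type*} [AddCommGroup M] [Module K M] (x : ℕ → M) (L : ℕ)
    (h : ∀ s < L, (1 + q) • x (s + 1) = q • x s + x (s + 2)) {s : ℕ} (hs : s ≤ L + 1) :
    qNat q (L + 1) • x s = (q ^ s * qNat q (L + 1 - s)) • x 0 + qNat q s • x (L + 1) := by
  have key : ∀ s ≤ L, x s = x 0 + qNat q s • (x 1 - x 0) ∧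
      x (s + 1) = x 0 + qNat q (s + 1) • (x 1 - x 0) := by
    intro s
    induction s with
    | zero => simp
    | succ s ih =>
      intro hs
      obtain ⟨h1, h2⟩ := ih (by omega)
      refine ⟨h2, ?_⟩
      have h3 := h s (by omega)
      rw [← sub_eq_iff_eq_add'] at h3
      rw [show s + 1 + 1 = s + 2 from rfl, ← h3, h2, h1]
      simp only [qNat_succ]
      module
  have lin : ∀ s ≤ L + 1, x s = x 0 + qNat q s • (x 1 - x 0) := by
    intro s hs
    cases s with
    | zero => simp
    | succ s => exact (key s (by omega)).2
  have e : qNat q (L + 1) = qNat q s + q ^ s * qNat q (L + 1 - s) := by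
    rw [← qNat_add, Nat.add_sub_cancel' hs]
  rw [lin s hs, lin (L + 1) le_rfl, e]
  module

variable {A : Type*} [CommRing A] [Algebra K A] (v : ℕ → A)

/-- The product `v_i v_{i+1} ⋯ v_{i+L-1}`. -/
def interval (i L : ℕ) : A := ∏ t ∈ Finset.range L, v (i + t)

lemma interval_eq_zero {i L j : ℕ} (hj : v j = 0) (h1 : i ≤ j) (h2 : j < i + L) :
    interval v i L = 0 :=
  Finset.prod_eq_zero (Finset.mem_range.2 (by omega : j - i < L))
    (by rwa [Nat.add_sub_cancel' h1])

lemma interval_succ (i L : ℕ) : interval v i (L + 1) = v (i + L) * interval v i L := by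
  rw [interval, Finset.prod_range_succ, mul_comm, interval]

lemma interval_succ' (i L : ℕ) : interval v i (L + 1) = v i * interval v (i + 1) L := by
  rw [interval, Finset.prod_range_succ', mul_comm, interval]
  simp only [add_zero, add_assoc, add_comm 1]

variable {v}

/-- Multiplying an interval monomial by one of its variables extends the interval to the left or
to the right. -/
lemma qNat_smul_mul_interval
    (hv : ∀ j, (1 + q) • v (j + 1) ^ 2 = q • (v (j + 1) * v j) + v (j + 1) * v (j + 2))
    (i L : ℕ) {s : ℕ} (hs : s ≤ L + 1) :
    qNat q (L + 1) • (v (i + s) * interval v (i + 1) L) =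
      (q ^ s * qNat q (L + 1 - s)) • interval v i (L + 1) +
        qNat q s • interval v (i + 1) (L + 1) := by
  rw [interval_succ', interval_succ, show i + 1 + L = i + (L + 1) by ring]
  refine qNat_smul_eq_of_recurrence (fun s => v (i + s) * interval v (i + 1) L) L
    (fun s hs => ?_) hs
  obtain ⟨w, hw⟩ : ∃ w, interval v (i + 1) L = v (i + s + 1) * w := by
    rw [show i + s + 1 = i + 1 + s by ring]
    exact Finset.dvd_prod_of_mem (fun t => v (i + 1 + t)) (Finset.mem_range.2 hs)
  have := congrArg (· * w) (hv (i + s))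
  simp only [add_mul, smul_mul_assoc] at this
  rw [hw, show i + (s + 1) = i + s + 1 by ring, show i + (s + 2) = i + s + 2 by ring]
  convert this using 2 <;> ring_nf

/-- The interval monomial of length `L` starting at `k + 1 - l`: the one reached from an interval
starting at `k + 1` by `l` extensions to the left. It is `0` if `l > k`, since it would contain
`v 0`; the case distinction keeps the natural subtraction meaningful. -/
def extended (v : ℕ → A) (k L l : ℕ) : A := if l ≤ k then interval v (k + 1 - l) L else 0

lemma qNat_smul_mul_extended
    (hv : ∀ j, (1 + q) • v (j + 1) ^ 2 = q • (v (j + 1) * v j) + v (j + 1) * v (j + 2))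
    (h0 : v 0 = 0) (α β k : ℕ) {t l : ℕ} (hl : l ≤ t) :
    qNat q (α + β + 1 + t + 1) • (v (k + β + 1) * extended v k (α + β + 1 + t) l) =
      (q ^ (β + 1 + l) * qNat q (α + 1 + (t - l))) • extended v k (α + β + 1 + t + 1) (l + 1) +
        qNat q (β + 1 + l) • extended v k (α + β + 1 + t + 1) l := by
  by_cases h : l ≤ k
  · have := qNat_smul_mul_interval hv (k - l) (α + β + 1 + t) (s := β + 1 + l) (by omega)
    rw [show k - l + (β + 1 + l) = k + β + 1 by omega,
      show α + β + 1 + t + 1 - (β + 1 + l) = α + 1 + (t - l) by omega] at this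
    simp only [extended, if_pos h, show k + 1 - l = k - l + 1 by omega]
    rw [this]
    congr 2
    split_ifs with h'
    · rw [show k + 1 - (l + 1) = k - l by omega]
    · exact interval_eq_zero v h0 (by omega) (by omega)
  · have h' : ¬ l + 1 ≤ k := by omega
    simp [extended, h, h']

/-- The coefficients obtained by repeatedly multiplying by the same variable obey the recurrence
of the permutation generating function. -/
lemma prod_qNat_smul_pow_mul_interval
    (hv : ∀ j, (1 + q) • v (j + 1) ^ 2 = q • (v (j + 1) * v j) + v (j + 1) * v (j + 2))
    (h0 : v 0 = 0) (hq : q ≠ 0) (α β k t : ℕ) :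
    (∏ s ∈ Finset.range t, qNat q (α + β + 1 + s + 1)) •
        (v (k + β + 1) ^ t * interval v (k + 1) (α + β + 1)) =
      ∑ l ∈ Finset.range (t + 1),
        weightSum (qNat q (α + 1)) (qNat q (β + 1)) (q ^ α) (q ^ β) q t l •
          extended v k (α + β + 1 + t) l := by
  induction t with
  | zero => simp [weightSum_zero_zero, extended]
  | succ t ih =>
    rw [Finset.prod_range_succ, mul_comm, mul_smul, pow_succ', mul_assoc, ← mul_smul_comm, ih,
      Finset.mul_sum, Finset.smul_sum]
    have step : ∀ l ∈ Finset.range (t + 1),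
        qNat q (α + β + 1 + t + 1) • (v (k + β + 1) *
          weightSum (qNat q (α + 1)) (qNat q (β + 1)) (q ^ α) (q ^ β) q t l •
            extended v k (α + β + 1 + t) l) =
        (q ^ (β + 1 + l) * qNat q (α + 1 + (t - l)) *
          weightSum (qNat q (α + 1)) (qNat q (β + 1)) (q ^ α) (q ^ β) q t l) •
            extended v k (α + β + 1 + t + 1) (l + 1) +
        (qNat q (β + 1 + l) *
          weightSum (qNat q (α + 1)) (qNat q (β + 1)) (q ^ α) (q ^ β) q t l) •
            extended v k (α + β + 1 + t + 1) l := by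
      intro l hl
      rw [mul_smul_comm, smul_comm, qNat_smul_mul_extended hv h0 α β k
        (by have := Finset.mem_range.1 hl; omega)]
      module
    rw [Finset.sum_congr rfl step, Finset.sum_add_distrib, Finset.sum_range_succ' _ (t + 1),
      weightSum_succ_zero _ _ _ (pow_ne_zero _ hq) (pow_ne_zero _ hq)]
    have split : ∑ l ∈ Finset.range (t + 1), (qNat q (β + 1 + l) *
          weightSum (qNat q (α + 1)) (qNat q (β + 1)) (q ^ α) (q ^ β) q t l) •
            extended v k (α + β + 1 + t + 1) l =
        ∑ l ∈ Finset.range (t + 1), (qNat q (β + 1 + (l + 1)) *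
          weightSum (qNat q (α + 1)) (qNat q (β + 1)) (q ^ α) (q ^ β) q t (l + 1)) •
            extended v k (α + β + 1 + t + 1) (l + 1) +
        (qNat q (β + 1) *
          weightSum (qNat q (α + 1)) (qNat q (β + 1)) (q ^ α) (q ^ β) q t 0) •
            extended v k (α + β + 1 + t + 1) 0 := by
      have := Finset.sum_range_succ' (fun l => (qNat q (β + 1 + l) *
          weightSum (qNat q (α + 1)) (qNat q (β + 1)) (q ^ α) (q ^ β) q t l) •
            extended v k (α + β + 1 + t + 1) l) (t + 1)
      rw [Finset.sum_range_succ, weightSum_eq_zero _ _ _ (Nat.lt_succ_self t), mul_zero, zero_smul,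
        add_zero] at this
      exact this
    rw [split, ← add_assoc, ← Finset.sum_add_distrib]
    refine congrArg₂ (· + ·) (Finset.sum_congr rfl fun l _ => ?_) rfl
    rw [weightSum_succ_succ _ _ _ (pow_ne_zero _ hq) (pow_ne_zero _ hq), ← add_smul]
    have e1 : qNat q (α + 1 + (t - l)) = qNat q (α + 1) + q ^ α * q * qNat q (t - l) := by
      rw [qNat_add, pow_succ]
    have e2 : qNat q (β + 1 + (l + 1)) = qNat q (β + 1) + q ^ β * q * qNat q (l + 1) := by
      rw [qNat_add, pow_succ]
    rw [e1, e2]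
    congr 2
    ring

/-- If the variables outside `{1, …, r}` vanish, only one interval monomial survives after the
number of steps that fills `{1, …, r}`. -/
lemma prod_qNat_smul_pow_mul_interval_eq
    (hv : ∀ j, (1 + q) • v (j + 1) ^ 2 = q • (v (j + 1) * v j) + v (j + 1) * v (j + 2))
    (h0 : v 0 = 0) (hq : q ≠ 0) {α β k n : ℕ} (hk : k ≤ n) (hr : v (α + β + n + 2) = 0) :
    (∏ s ∈ Finset.range n, qNat q (α + β + 1 + s + 1)) •
        (v (k + β + 1) ^ n * interval v (k + 1) (α + β + 1)) =
      weightSum (qNat q (α + 1)) (qNat q (β + 1)) (q ^ α) (q ^ β) q n k •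
        interval v 1 (α + β + 1 + n) := by
  rw [prod_qNat_smul_pow_mul_interval hv h0 hq, Finset.sum_eq_single k]
  · simp [extended]
  · intro l _ hl
    rw [extended]
    split_ifs with h
    · rw [interval_eq_zero v hr (by omega) (by omega), smul_zero]
    · exact smul_zero _
  · intro h
    exact absurd (Finset.mem_range.2 (by omega)) h

end Expansion

section ListMonomial

variable {A : Type*} [CommRing A] (v : ℕ → A)

/-- The monomial `v_s^{c₁} v_{s+1}^{c₂} ⋯` with exponents `c₁, c₂, …` read from a list. -/
def listMonomial : ℕ → List ℕ → A
  | _, [] => 1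
  | s, c :: l => v s ^ c * listMonomial (s + 1) l

lemma listMonomial_eq_prod (s : ℕ) (c : List ℕ) :
    listMonomial v s c = ∏ i : Fin c.length, v (s + i) ^ c.get i := by
  induction c generalizing s with
  | nil => simp [listMonomial]
  | cons a l ih =>
    rw [listMonomial, ih]
    simp only [List.length_cons, Fin.prod_univ_succ]
    simp [add_assoc, add_comm 1]

lemma listMonomial_append (s : ℕ) (c d : List ℕ) :
    listMonomial v s (c ++ d) = listMonomial v s c * listMonomial v (s + c.length) d := by
  induction c generalizing s with
  | nil => simp [listMonomial]
  | cons a l ih =>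
    simp only [List.cons_append, listMonomial, ih, List.length_cons, mul_assoc, add_assoc,
      add_comm 1]

lemma listMonomial_replicate_zero (s m : ℕ) : listMonomial v s (List.replicate m 0) = 1 := by
  simp [listMonomial_eq_prod]

lemma listMonomial_replicate_one (s m : ℕ) :
    listMonomial v s (List.replicate m 1) = interval v s m := by
  induction m generalizing s with
  | zero => simp [listMonomial, interval]
  | succ m ih => rw [List.replicate_succ, listMonomial, ih, interval_succ', pow_one]

lemma interval_add (i L M : ℕ) : interval v i (L + M) = interval v i L * interval v (i + L) M := by
  simp only [interval, Finset.prod_range_add, add_assoc]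

lemma listMonomial_carlitzScoville (k n α β : ℕ) (m : ℕ) :
    listMonomial v 1 (List.replicate k 0 ++ List.replicate β 1 ++ [n + 1] ++
      List.replicate α 1 ++ List.replicate m 0) =
    v (k + β + 1) ^ n * interval v (k + 1) (α + β + 1) := by
  simp only [listMonomial_append, listMonomial_replicate_zero, listMonomial_replicate_one,
    listMonomial, List.length_append, List.length_replicate, List.length_singleton, one_mul,
    mul_one]
  rw [show α + β + 1 = β + (1 + α) by ring, interval_add, interval_add]
  simp only [interval, Finset.prod_range_one, add_zero]
  rw [show 1 + k = k + 1 by ring, show 1 + (k + β) = k + 1 + β by ring,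
    show 1 + (k + β + 1) = k + 1 + β + 1 by ring, show k + β + 1 = k + 1 + β by ring, pow_succ]
  ring

end ListMonomial

/-! ### Evaluation of the Carlitz–Scoville numbers -/

/-- The generators of the Klyachko algebra, with `u_j = 0` for `j ∉ {1, …, r}`. -/
noncomputable def gen (r j : ℕ) : Klyachko r := Ideal.Quotient.mk (relations r) (u r j)

lemma gen_eq_zero {r j : ℕ} (h : ¬ (1 ≤ j ∧ j ≤ r)) : gen r j = 0 := by
  rw [gen, u, dif_neg h, map_zero]

lemma gen_relation (r j : ℕ) :
    (1 + RemixedEulerian.q) • gen r (j + 1) ^ 2 =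
      RemixedEulerian.q • (gen r (j + 1) * gen r j) + gen r (j + 1) * gen r (j + 2) := by
  by_cases h : j + 1 ≤ r
  · have hmem : MvPolynomial.C (1 + RemixedEulerian.q) * u r (j + 1) ^ 2
        - (MvPolynomial.C RemixedEulerian.q * u r (j + 1) * u r (j + 1 - 1) +
          u r (j + 1) * u r (j + 1 + 1)) ∈ relations r :=
      Ideal.subset_span ⟨j + 1, by omega, h, rfl⟩
    rw [← Ideal.Quotient.eq_zero_iff_mem, map_sub, sub_eq_zero, mul_assoc,
      ← MvPolynomial.smul_eq_C_mul, ← MvPolynomial.smul_eq_C_mul] at hmem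
    exact hmem
  · simp [gen_eq_zero (r := r) (j := j + 1) (by omega)]

lemma mono_eq_prod_gen (r : ℕ) (c : Fin r → ℕ) :
    mono r c = ∏ i : Fin r, gen r (1 + i) ^ c i := by
  rw [mono, map_prod]
  refine Finset.prod_congr rfl fun i _ => ?_
  rw [map_pow, gen, u, dif_pos (by omega)]
  congr 4
  exact Fin.ext (by simp)

lemma mono_get (c : List ℕ) : mono c.length c.get = listMonomial (gen c.length) 1 c := by
  rw [mono_eq_prod_gen, listMonomial_eq_prod]

lemma mono_one (r : ℕ) : mono r (fun _ => 1) = interval (gen r) 1 r := by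
  rw [mono_eq_prod_gen, interval, Finset.prod_range]
  simp

lemma q_ne_zero : RemixedEulerian.q ≠ 0 := RatFunc.X_ne_zero

lemma qFactorial_ne_zero (m : ℕ) : qFactorial m ≠ 0 :=
  Finset.prod_ne_zero_iff.2 fun i _ => qInt_succ_ne_zero i

lemma qFactorial_add (m n : ℕ) :
    qFactorial (m + n) =
      qFactorial m * ∏ s ∈ Finset.range n, qNat RemixedEulerian.q (m + s + 1) := by
  rw [qFactorial, Finset.prod_range_add]
  rfl

lemma E_eq_weightSum {n k : ℕ} (hk : k ≤ n) (α β : ℕ) :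
    RemixedEulerian.E n k (α + 1) (β + 1) =
      weightSum (qInt (α + 1)) (qInt (β + 1)) (RemixedEulerian.q ^ α) (RemixedEulerian.q ^ β)
        RemixedEulerian.q n k := by
  rw [RemixedEulerian.E, if_pos hk, carlitzScoville, div_eq_iff (qFactorial_ne_zero _)]
  apply remixed_eq
  rw [mono_get, mono_one, Nat.add_sub_cancel' hk, Nat.add_sub_cancel, Nat.add_sub_cancel,
    listMonomial_carlitzScoville]
  have hlen : (List.replicate k 0 ++ List.replicate β 1 ++ [n + 1] ++ List.replicate α 1 ++
      List.replicate (n - k) 0).length = α + β + 1 + n := by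
    simp only [List.length_append, List.length_replicate, List.length_singleton]
    omega
  rw [hlen, show α + 1 + (β + 1) - 1 = α + β + 1 by omega, qFactorial_add, mul_smul,
    prod_qNat_smul_pow_mul_interval_eq (gen_relation _) (gen_eq_zero (by omega)) q_ne_zero hk
      (gen_eq_zero (by omega)), smul_smul, mul_comm]
  rfl

/-! ### Real parameters -/

open RealParam in
lemma qReal_natCast_add {q : ℝ} (hq : 0 < q) (α : ℝ) (N : ℕ) :
    qReal q (N + α) = qReal q α + q ^ (α - 1) * q * qNat q N := by
  have e : q ^ (α - 1) * q = q ^ α := by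
    rw [← Real.rpow_add_one hq.ne', sub_add_cancel]
  rw [e, qReal, qReal]
  split_ifs with h
  · subst h
    simp [qNat, add_comm]
  · have h1 : 1 - q ≠ 0 := sub_ne_zero.2 (Ne.symm h)
    have hg : qNat q N * (1 - q) = 1 - q ^ N := geom_sum_mul_neg q N
    rw [Real.rpow_add hq, Real.rpow_natCast, div_add' _ _ _ h1]
    congr 1
    linear_combination (-q ^ α) * hg

lemma realE_eq_weightSum {α β q : ℝ} (hq : 0 < q) (n k : ℕ) :
    RealParam.E α β q n k =
      weightSum (RealParam.qReal q α) (RealParam.qReal q β) (q ^ (α - 1)) (q ^ (β - 1)) q n k := by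
  have hx : q ^ (α - 1) ≠ 0 := (Real.rpow_pos_of_pos hq _).ne'
  have hy : q ^ (β - 1) ≠ 0 := (Real.rpow_pos_of_pos hq _).ne'
  induction n generalizing k with
  | zero =>
    cases k with
    | zero => rw [RealParam.E, weightSum_zero_zero]
    | succ k => rw [RealParam.E, weightSum_eq_zero _ _ _ (Nat.succ_pos k)]
  | succ n ih =>
    cases k with
    | zero => rw [RealParam.E, ih, weightSum_succ_zero _ _ _ hx hy]
    | succ k =>
      rw [RealParam.E, ih, ih, weightSum_succ_succ _ _ _ hx hy]
      have e2 := qReal_natCast_add hq β (k + 1)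
      push_cast at e2
      rw [e2]
      congr 1
      rcases Nat.lt_or_ge n k with h | h
      · rw [weightSum_eq_zero _ _ _ h, mul_zero, mul_zero]
      · have e1 := qReal_natCast_add hq α (n - k)
        rw [Nat.cast_sub h] at e1
        have e3 : q ^ (β + k) = q ^ (β - 1) * q ^ (k + 1) := by
          rw [← Real.rpow_natCast, ← Real.rpow_add hq]
          congr 1
          push_cast
          ring
        rw [e1, e3]

lemma zpow_mixedMaj {K : Type*} [Field K] {q : K} (hq : q ≠ 0) (α β : ℕ) {m : ℕ}
    (σ : Equiv.Perm (Fin m)) :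
    q ^ PermStat.mixedMaj ((α + 1 : ℕ) : ℤ) ((β + 1 : ℕ) : ℤ) σ =
      (q ^ α) ^ (1 + (PermStat.des σ : ℤ) - PermStat.lrmin σ) *
        (q ^ β) ^ ((m : ℤ) - PermStat.rlmin σ) * q ^ PermStat.maj σ := by
  rw [PermStat.mixedMaj, zpow_add₀ hq, zpow_add₀ hq, zpow_natCast, ← zpow_natCast q α,
    ← zpow_natCast q β, ← zpow_mul, ← zpow_mul]
  congr 3 <;> (push_cast; ring)

lemma rpow_mixedMaj {q : ℝ} (hq : 0 < q) (α β : ℝ) {m : ℕ} (σ : Equiv.Perm (Fin m)) :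
    q ^ PermStat.mixedMaj α β σ =
      (q ^ (α - 1)) ^ (1 + (PermStat.des σ : ℤ) - PermStat.lrmin σ) *
        (q ^ (β - 1)) ^ ((m : ℤ) - PermStat.rlmin σ) * q ^ PermStat.maj σ := by
  rw [PermStat.mixedMaj, Real.rpow_add hq, Real.rpow_add hq, Real.rpow_natCast,
    ← Real.rpow_intCast, ← Real.rpow_intCast, ← Real.rpow_mul hq.le, ← Real.rpow_mul hq.le]
  congr 3 <;> (push_cast; ring)

end QCarlitz

theorem theorem1 (n k : ℕ) (hk : k ≤ n) :
    (∀ α β : ℕ, 1 ≤ α → 1 ≤ β →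
      RemixedEulerian.E n k α β =
        ∑ σ : Equiv.Perm (Fin (n + 1)) with PermStat.des σ = k,
          RemixedEulerian.qInt α ^ (PermStat.lrmin σ - 1) *
            RemixedEulerian.qInt β ^ (PermStat.rlmin σ - 1) *
            RemixedEulerian.q ^ PermStat.mixedMaj (α : ℤ) (β : ℤ) σ) ∧
    (∀ α β q : ℝ, 0 < q →
      RealParam.E α β q n k =
        ∑ σ : Equiv.Perm (Fin (n + 1)) with PermStat.des σ = k,
          RealParam.qReal q α ^ (PermStat.lrmin σ - 1) *
            RealParam.qReal q β ^ (PermStat.rlmin σ - 1) *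
            q ^ PermStat.mixedMaj α β σ) := by
  constructor
  · intro α β hα hβ
    obtain ⟨α, rfl⟩ := Nat.exists_eq_add_of_le' hα
    obtain ⟨β, rfl⟩ := Nat.exists_eq_add_of_le' hβ
    rw [QCarlitz.E_eq_weightSum hk, QCarlitz.weightSum]
    refine Finset.sum_congr rfl fun σ _ => ?_
    rw [QCarlitz.zpow_mixedMaj QCarlitz.q_ne_zero, QCarlitz.weight]
    ring
  · intro α β q hq
    rw [QCarlitz.realE_eq_weightSum hq, QCarlitz.weightSum]
    refine Finset.sum_congr rfl fun σ _ => ?_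
    rw [QCarlitz.rpow_mixedMaj hq, QCarlitz.weight]
    ring
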